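/- Let $(\Omega,\mathcal F,(\mathcal F_\tau)_{\tau\ge\tau_0},P)$ be a filtered probability space satisfying the usual conditions, and let $W=(W^1,\dots,W^n)^\top$, $n\ge 1$, be a vector of independent Brownian motions with respect to this filtration, started at time $\tau_0\in\mathbb R$. Consider a market of $n$ nonnegative factors $S^1,\dots,S^n$, denominated in units of the savings account $S^0\equiv 1$, with $S^k_{\tau_0}>0$ and $$\frac{dS^k_\tau}{S^k_\tau}=\hat\lambda_\tau\,d\tau+\beta^k_\tau\,(\beta^k_\tau\,\omega^k\,d\tau+dW^k_\tau),\qquad k=1,\dots,n .$$ Here the volatilities $\beta^k$ are continuous, adapted and strictly positive, the risk premium parameters $\omega^k>0$ are constants, and $\hat\lambda$ is progressively measurable and pathwise locally square-integrable; a factor that reaches zero is instantaneously reflected, that is, it spends no time at zero. Let $\beta_\tau$ be the diagonal matrix with entries $\beta^k_\tau$, $\omega=(\omega^1,\dots,\omega^n)^\top$ and $\mathbf 1=(1,\dots,1)^\top$. It is assumed that the market of factors has a growth optimal portfolio whose Lagrange multiplier is the net risk-adjusted return $\hat\lambda_\tau$: almost surely, for all $\tau$, the problem of maximizing $\pi^\top(\hat\lambda_\tau\mathbf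 1+\beta_\tau^2\omega)-\frac12\pi^\top\beta_\tau^2\pi$ over $\pi\in\mathbb R^n$ with $\pi^\top\mathbf 1=1$ has a solution, with Lagrange multiplier $\hat\lambda_\tau$ for the constraint. In the extended market of the savings account and the factors, a positive self-financing portfolio $S^\pi$ with weights $(\pi^0,\pi^\top)^\top$, $\pi^0+\pi^\top\mathbf 1=1$, satisfies $dS^\pi/S^\pi=\sum_{k=1}^n\pi^k\,dS^k/S^k$ and has the instantaneous growth rate $$g^\pi_\tau=\pi_\tau^\top\mathbf 1\,\hat\lambda_\tau+\pi_\tau^\top\beta_\tau\beta_\tau\left(\omega-\tfrac12\pi_\tau\right).$$ A numéraire portfolio (NP) $S^{**}$ is a positive self-financing portfolio of the extended market whose weights $(\pi^{**,0}_\tau,\pi^{**\top}_\tau)^\top$ maximize, almost surely for all $\tau\ge\tau_0$, the growth rate $g^\pi_\tau$ over all $(\pi^0,\pi^\top)^\top\in\mathbb R^{n+1}$ with $\pi^0+\pi^\top\mathbf 1=1$. Put $$\theta^{**}_\tau=\hat\lambda_\tau\,\beta_\tau^{-1}\mathbf 1+\beta_\tau\,\omega .$$ Then $\theta^{**}$ is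 the market price of risk vector of the extended market, i.e. $\beta_\tau\theta^{**}_\tau=\hat\lambda_\tau\mathbf 1+\beta_\tau^2\omega$. Almost surely, for all $\tau\ge\tau_0$, the above maximization problem of the extended market has exactly one solution, which is $$\pi^{**}_\tau=\hat\lambda_\tau\,\beta_\tau^{-2}\mathbf 1+\omega,\qquad \pi^{**,0}_\tau=-\hat\lambda_\tau\,\mathbf 1^\top\beta_\tau^{-2}\mathbf 1 .$$ Consequently every numéraire portfolio $S^{**}$ invests the weights $\pi^{**}_\tau$ in the factors and the weight $\pi^{**,0}_\tau$ in the savings account, and it satisfies $$\frac{dS^{**}_\tau}{S^{**}_\tau}=\theta^{**\top}_\tau\left(\theta^{**}_\tau\,d\tau+dW_\tau\right),\qquad S^{**}_{\tau_0}>0 .$$ -/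

import Mathlib

open MeasureTheory ProbabilityTheory Filter Topology
open scoped NNReal ENNReal Matrix

namespace NumeraireMarket

/-- Market times: the half line of all times not before the initial market time `τ₀`.
Its least element `⊥` is `τ₀`. -/
abbrev MarketTime (τ₀ : ℝ) : Type := Set.Ici τ₀

/-- Lebesgue measure on the market times. -/
noncomputable def timeMeasure (τ₀ : ℝ) : Measure (MarketTime τ₀) :=
  (volume : Measure ℝ).comap Subtype.val

/-! ### Stochastic analysis -/

section StochasticAnalysis

variable {Ω : Type*} {mΩ : MeasurableSpace Ω} {τ₀ : ℝ} {n : ℕ}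

/-- The usual conditions: the filtration is right-continuous, and every set of (outer)
`P`-measure zero already belongs to the initial σ-algebra. -/
def UsualConditions (𝓕 : Filtration (MarketTime τ₀) mΩ) (P : Measure Ω) : Prop :=
  𝓕.IsRightContinuous ∧ ∀ N : Set Ω, P N = 0 → MeasurableSet[𝓕 ⊥] N

/-- `W = (W¹, …, Wⁿ)` is an `n`-dimensional Brownian motion with respect to the filtration `𝓕`,
started at time `τ₀`: its components are independent one-dimensional Brownian motions, they are
adapted to `𝓕`, and increments after time `s` are independent of `𝓕 s`. -/
structure IsFiltrationBrownian (𝓕 : Filtration (MarketTime τ₀) mΩ) (P : Measure Ω)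
    (W : Fin n → MarketTime τ₀ → Ω → ℝ) : Prop where
  brownian : ∀ k, IsBrownianReal
    (fun t : ℝ≥0 => W k ⟨τ₀ + (t : ℝ), le_add_of_nonneg_right t.2⟩) P
  independent : iIndepFun (fun k x => fun t : MarketTime τ₀ => W k t x) P
  adapted : ∀ k, StronglyAdapted 𝓕 (W k)
  indep_increment : ∀ s t : MarketTime τ₀, s ≤ t →
    Indep (MeasurableSpace.comap (fun x => fun k => W k t x - W k s x) MeasurableSpace.pi)
      (𝓕 s) P

/-- A simple integrand `∑_{i < N} ξ i · 1_{(t i, t (i+1)]}`, with `ξ i` bounded and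
`𝓕 (t i)`-measurable. -/
structure SimpleIntegrand (𝓕 : Filtration (MarketTime τ₀) mΩ) where
  N : ℕ
  t : ℕ → MarketTime τ₀
  t_mono : Monotone t
  ξ : ℕ → Ω → ℝ
  measurable_ξ : ∀ i, StronglyMeasurable[𝓕 (t i)] (ξ i)
  bounded_ξ : ∃ C : ℝ, ∀ i x, |ξ i x| ≤ C

/-- The process `∑_{i < N} ξ i · 1_{(t i, t (i+1)]}`. -/
noncomputable def SimpleIntegrand.process {𝓕 : Filtration (MarketTime τ₀) mΩ}
    (φ : SimpleIntegrand 𝓕) (s : MarketTime τ₀) (x : Ω) : ℝ :=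
  ∑ i ∈ Finset.range φ.N, (Set.Ioc (φ.t i) (φ.t (i + 1))).indicator (fun _ => φ.ξ i x) s

/-- The elementary integral `∑_{i < N} ξ i · (B (t (i+1) ∧ u) - B (t i ∧ u))`. -/
noncomputable def SimpleIntegrand.integral {𝓕 : Filtration (MarketTime τ₀) mΩ}
    (φ : SimpleIntegrand 𝓕) (B : MarketTime τ₀ → Ω → ℝ) (u : MarketTime τ₀) (x : Ω) : ℝ :=
  ∑ i ∈ Finset.range φ.N, φ.ξ i x * (B (min (φ.t (i + 1)) u) x - B (min (φ.t i) u) x)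

/-- `I` is (a version of) the Itô integral `∫ H dB` of the progressively measurable and
pathwise locally square-integrable integrand `H`: it is adapted, has continuous paths, and is the
limit in probability, at each time, of the elementary integrals of simple integrands `φ m`
with `∫_{τ₀}^u |φ m - H|² ds → 0` in probability for each `u`.
For a Brownian motion `B` of the filtration this determines `I` up to indistinguishability. -/
structure IsItoIntegral (𝓕 : Filtration (MarketTime τ₀) mΩ) (P : Measure Ω)
    (B H I : MarketTime τ₀ → Ω → ℝ) : Prop where
  progressive : IsStronglyProgressive 𝓕 H
  locally_sq_integrable : ∀ᵐ x ∂P, ∀ u : MarketTime τ₀,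
    ∫⁻ s in Set.Iic u, ‖H s x‖ₑ ^ 2 ∂timeMeasure τ₀ < ∞
  adapted : StronglyAdapted 𝓕 I
  continuous : ∀ᵐ x ∂P, Continuous fun u => I u x
  limit : ∃ φ : ℕ → SimpleIntegrand 𝓕, ∀ u : MarketTime τ₀,
    (∀ ε : ℝ≥0∞, 0 < ε → Tendsto (fun m =>
      P {x | ε ≤ ∫⁻ s in Set.Iic u, ‖(φ m).process s x - H s x‖ₑ ^ 2 ∂timeMeasure τ₀}) atTop (𝓝 0)) ∧
    TendstoInMeasure P (fun m => (φ m).integral B u) atTop (I u)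

/-- `X` is an Itô process with stochastic differential `dX = a dτ + ∑ₖ b k dWᵏ`, that is,
almost surely `X u = X τ₀ + ∫_{τ₀}^u a ds + ∑ₖ ∫_{τ₀}^u b k dWᵏ` for all `u ≥ τ₀`. -/
structure HasItoDifferential (𝓕 : Filtration (MarketTime τ₀) mΩ) (P : Measure Ω)
    (W : Fin n → MarketTime τ₀ → Ω → ℝ) (X a : MarketTime τ₀ → Ω → ℝ)
    (b : Fin n → MarketTime τ₀ → Ω → ℝ) : Prop where
  progressive : IsStronglyProgressive 𝓕 X
  drift_progressive : IsStronglyProgressive 𝓕 a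
  drift_integrable : ∀ᵐ x ∂P, ∀ u : MarketTime τ₀,
    IntegrableOn (fun s => a s x) (Set.Iic u) (timeMeasure τ₀)
  representation : ∃ I : Fin n → MarketTime τ₀ → Ω → ℝ,
    (∀ k, IsItoIntegral 𝓕 P (W k) (b k) (I k)) ∧
    ∀ᵐ x ∂P, ∀ u : MarketTime τ₀,
      X u x = X ⊥ x + (∫ s in Set.Iic u, a s x ∂timeMeasure τ₀) + ∑ k, I k u x

/-- `dY = ∑ᵢ H i dXⁱ` for Itô processes `Xⁱ`. The integral `∫ H dX` against an Itô process with
`dX = a dτ + ∑ₖ b k dWᵏ` is the Itô process with differential `H a dτ + ∑ₖ H b k dWᵏ`; as usual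
it does not depend on the representation chosen for `X`. -/
def HasIntegralDifferential {m : ℕ} (𝓕 : Filtration (MarketTime τ₀) mΩ) (P : Measure Ω)
    (W : Fin n → MarketTime τ₀ → Ω → ℝ) (Y : MarketTime τ₀ → Ω → ℝ)
    (H X : Fin m → MarketTime τ₀ → Ω → ℝ) : Prop :=
  (∀ i, ∃ a b, HasItoDifferential 𝓕 P W (X i) a b) ∧
  ∀ (a : Fin m → MarketTime τ₀ → Ω → ℝ) (b : Fin m → Fin n → MarketTime τ₀ → Ω → ℝ),
    (∀ i, HasItoDifferential 𝓕 P W (X i) (a i) (b i)) →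
    HasItoDifferential 𝓕 P W Y (fun s x => ∑ i, H i s x * a i s x)
      (fun k s x => ∑ i, H i s x * b i k s x)

/-- `V` is a positive self-financing portfolio of the securities `X`, with the fraction
`π i` of its value invested in `Xⁱ`: the weights are progressively measurable and add up to one,
and `dV / V = ∑ᵢ π i dXⁱ / Xⁱ`. -/
structure IsPositivePortfolio {m : ℕ} (𝓕 : Filtration (MarketTime τ₀) mΩ) (P : Measure Ω)
    (W : Fin n → MarketTime τ₀ → Ω → ℝ) (X : Fin m → MarketTime τ₀ → Ω → ℝ)
    (V : MarketTime τ₀ → Ω → ℝ) (π : Fin m → MarketTime τ₀ → Ω → ℝ) : Prop where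
  weights_progressive : ∀ i, IsStronglyProgressive 𝓕 (π i)
  weights_sum : ∀ᵐ x ∂P, ∀ τ, ∑ i, π i τ x = 1
  positive : ∀ᵐ x ∂P, ∀ τ, 0 < V τ x
  self_financing : HasIntegralDifferential 𝓕 P W V (fun i s x => V s x * π i s x / X i s x) X

end StochasticAnalysis

/-! ### Growth rates and their constrained maximization -/

section GrowthRate

variable {m n : ℕ}

/-- The instantaneous growth rate, i.e. the drift `πᵀμ - ½ |σᵀπ|²` of the logarithm, of a
portfolio with weights `π` in `m` securities with rates of return `μ` and volatility
matrix `σ` (row `i` holds the volatilities of security `i` with respect to the `n` Brownian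
motions). -/
noncomputable def growthRate (μ : Fin m → ℝ) (σ : Matrix (Fin m) (Fin n) ℝ)
    (π : Fin m → ℝ) : ℝ :=
  π ⬝ᵥ μ - (1 / 2) * ((π ᵥ* σ) ⬝ᵥ (π ᵥ* σ))

/-- `π` solves `max { g p | p ∈ ℝᵐ, pᵀ1 = 1 }`. -/
def IsConstrainedMaximizer (g : (Fin m → ℝ) → ℝ) (π : Fin m → ℝ) : Prop :=
  ∑ i, π i = 1 ∧ ∀ p : Fin m → ℝ, ∑ i, p i = 1 → g p ≤ g π

/-- `ℓ` is the Lagrange multiplier of the problem `max { g p | p ∈ ℝᵐ, pᵀ1 = 1 }`: the problem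
has a solution that is a critical point of the Lagrangian `g p + ℓ (1 - pᵀ1)`. -/
def IsLagrangeMultiplier (g : (Fin m → ℝ) → ℝ) (ℓ : ℝ) : Prop :=
  ∃ π : Fin m → ℝ, IsConstrainedMaximizer g π ∧
    HasFDerivAt (fun p : Fin m → ℝ => g p + ℓ * (1 - ∑ i, p i)) (0 : (Fin m → ℝ) →L[ℝ] ℝ) π

end GrowthRate

/-! ### The market of factors and the extended market -/

section Market

variable {Ω : Type*} {mΩ : MeasurableSpace Ω} {τ₀ : ℝ} {n : ℕ}

/-- The diagonal matrix of the factor volatilities. -/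
noncomputable def volMatrix (β : Fin n → MarketTime τ₀ → Ω → ℝ) (τ : MarketTime τ₀) (x : Ω) :
    Matrix (Fin n) (Fin n) ℝ :=
  Matrix.diagonal fun k => β k τ x

/-- The rates of return `lam 1 + β β ω` of the factors. -/
noncomputable def factorReturn (lam : MarketTime τ₀ → Ω → ℝ)
    (β : Fin n → MarketTime τ₀ → Ω → ℝ) (ω : Fin n → ℝ) (τ : MarketTime τ₀) (x : Ω) :
    Fin n → ℝ :=
  lam τ x • (1 : Fin n → ℝ) + (volMatrix β τ x * volMatrix β τ x) *ᵥ ω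

/-- The market of `n` factors `S`, driven by the Brownian motions `W`, with net risk-adjusted
return `lam`, factor volatilities `β` and risk premium parameters `ω`. -/
structure IsFactorMarket (𝓕 : Filtration (MarketTime τ₀) mΩ) (P : Measure Ω)
    (W : Fin n → MarketTime τ₀ → Ω → ℝ) (lam : MarketTime τ₀ → Ω → ℝ)
    (β : Fin n → MarketTime τ₀ → Ω → ℝ) (ω : Fin n → ℝ)
    (S : Fin n → MarketTime τ₀ → Ω → ℝ) : Prop where
  usual_conditions : UsualConditions 𝓕 P
  brownian : IsFiltrationBrownian 𝓕 P W
  lam_progressive : IsStronglyProgressive 𝓕 lam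
  lam_sq_integrable : ∀ᵐ x ∂P, ∀ u : MarketTime τ₀,
    ∫⁻ s in Set.Iic u, ‖lam s x‖ₑ ^ 2 ∂timeMeasure τ₀ < ∞
  vol_adapted : ∀ k, StronglyAdapted 𝓕 (β k)
  vol_continuous : ∀ k x, Continuous fun τ => β k τ x
  vol_pos : ∀ k τ x, 0 < β k τ x
  premium_pos : ∀ k, 0 < ω k
  factor_initial : ∀ k, ∀ᵐ x ∂P, 0 < S k ⊥ x
  factor_nonneg : ∀ k, ∀ᵐ x ∂P, ∀ τ, 0 ≤ S k τ x
  /-- Should a factor reach zero, it is instantaneously reflected: it spends no time at zero. -/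
  factor_reflected : ∀ k, ∀ᵐ x ∂P, timeMeasure τ₀ {τ | S k τ x = 0} = 0
  /-- `dSᵏ / Sᵏ = lam dτ + βᵏ (βᵏ ωᵏ dτ + dWᵏ)`. -/
  factor_sde : ∀ k, HasItoDifferential 𝓕 P W (S k)
    (fun τ x => S k τ x * (lam τ x + β k τ x * (β k τ x * ω k)))
    (fun j τ x => if j = k then S k τ x * β k τ x else 0)
  /-- The growth rate maximization over all portfolios of factors, which identifies the growth
  optimal portfolio of the factors, has a solution, and `lam` is its Lagrange multiplier. -/
  net_risk_adjusted_return : ∀ᵐ x ∂P, ∀ τ,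
    IsLagrangeMultiplier (growthRate (factorReturn lam β ω τ x) (volMatrix β τ x)) (lam τ x)

/-- The securities of the extended market: the savings account `S⁰ ≡ 1` at index `0`, followed by
the factors. -/
def extendedSecurities (S : Fin n → MarketTime τ₀ → Ω → ℝ) :
    Fin (n + 1) → MarketTime τ₀ → Ω → ℝ :=
  Fin.cons (fun _ _ => 1) S

/-- The instantaneous growth rate, as a function of the weights `(π⁰, π¹, …, πⁿ)`, of portfolios
in the extended market: the savings account has zero return and zero volatility. -/
noncomputable def extendedGrowthRate (lam : MarketTime τ₀ → Ω → ℝ)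
    (β : Fin n → MarketTime τ₀ → Ω → ℝ) (ω : Fin n → ℝ) (τ : MarketTime τ₀) (x : Ω) :
    (Fin (n + 1) → ℝ) → ℝ :=
  growthRate (Fin.cons 0 (factorReturn lam β ω τ x))
    (Matrix.of (Fin.cons 0 (fun k => volMatrix β τ x k) : Fin (n + 1) → Fin n → ℝ))

/-- `V` is a numéraire portfolio, with weights `π`: a positive portfolio of the
savings account and the factors whose weights maximize the instantaneous growth rate at
all times. -/
structure IsNumerairePortfolio (𝓕 : Filtration (MarketTime τ₀) mΩ) (P : Measure Ω)
    (W : Fin n → MarketTime τ₀ → Ω → ℝ) (lam : MarketTime τ₀ → Ω → ℝ)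
    (β : Fin n → MarketTime τ₀ → Ω → ℝ) (ω : Fin n → ℝ)
    (S : Fin n → MarketTime τ₀ → Ω → ℝ)
    (V : MarketTime τ₀ → Ω → ℝ) (π : Fin (n + 1) → MarketTime τ₀ → Ω → ℝ) : Prop where
  portfolio : IsPositivePortfolio 𝓕 P W (extendedSecurities S) V π
  growth_optimal : ∀ᵐ x ∂P, ∀ τ,
    IsConstrainedMaximizer (extendedGrowthRate lam β ω τ x) (fun i => π i τ x)

/-- `θ` is a market price of risk vector at time `τ`: the rate of return of each factor in excess
of the (zero) rate of the savings account is the inner product of its volatilities with `θ`. -/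
def IsMarketPriceOfRisk (lam : MarketTime τ₀ → Ω → ℝ)
    (β : Fin n → MarketTime τ₀ → Ω → ℝ) (ω : Fin n → ℝ) (τ : MarketTime τ₀) (x : Ω)
    (θ : Fin n → ℝ) : Prop :=
  factorReturn lam β ω τ x = volMatrix β τ x *ᵥ θ

end Market

end NumeraireMarket

/-! Completing the square settles the optimization. Since the return vector is `β θ`, the growth
rate of a portfolio with factor weights `p` is `½|θ|² - ½ ∑ (pₖ βₖ - θₖ)²`
(`extendedGrowthRate_eq`). The savings account has neither return nor volatility, so its weight
absorbs the budget constraint and the factor weights are free. The squares vanish exactly at `pₖ =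
θₖ / βₖ = lam / βₖ² + ωₖ`, the unique maximizer.

The budget then leaves `1 - ∑ ωₖ - lam ∑ βₖ⁻²` for the savings account, and the stated weight
requires `∑ ωₖ = 1`. This comes from the growth optimal portfolio of the factors alone
(`sum_premium_eq_one`): with multiplier `lam` the Lagrangian is a constant minus `½ ∑ (βₖ (pₖ -
ωₖ))²`. Its only critical point is `ω`, so the constrained solution is `ω` and satisfies the budget.

For the SDE, the optimal weights are inserted into the self-financing equation. Factor `k`
contributes drift `V (θₖ / (βₖ Sₖ)) · Sₖ βₖ θₖ = V θₖ²` and diffusion `V θₖ`. Cancelling `Sₖ` is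
legitimate only where `Sₖ ≠ 0`, which by reflection is almost every time. The coefficients therefore
agree only almost everywhere in time, and the `congr` lemmas show that this is enough. -/

namespace NumeraireMarket

/-! ### Itô differentials depend on their coefficients only up to null sets of times. -/

section StochasticAnalysis

variable {Ω : Type*} {mΩ : MeasurableSpace Ω} {τ₀ : ℝ} {n : ℕ}
  {𝓕 : Filtration (MarketTime τ₀) mΩ} {P : Measure Ω}

/-- The Itô integral does not change if the integrand is replaced by a progressively measurable
process that agrees with it at almost all times. -/
theorem IsItoIntegral.congr {B H H' I : MarketTime τ₀ → Ω → ℝ} (h : IsItoIntegral 𝓕 P B H I)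
    (hH' : IsStronglyProgressive 𝓕 H')
    (hae : ∀ᵐ x ∂P, ∀ᵐ s ∂timeMeasure τ₀, H s x = H' s x) :
    IsItoIntegral 𝓕 P B H' I where
  progressive := hH'
  locally_sq_integrable := by
    filter_upwards [h.locally_sq_integrable, hae] with x hx hxe u
    have heq : ∫⁻ s in Set.Iic u, ‖H' s x‖ₑ ^ 2 ∂timeMeasure τ₀
        = ∫⁻ s in Set.Iic u, ‖H s x‖ₑ ^ 2 ∂timeMeasure τ₀ := by
      refine lintegral_congr_ae (ae_restrict_of_ae ?_)
      filter_upwards [hxe] with s hs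
      rw [hs]
    rw [heq]
    exact hx u
  adapted := h.adapted
  continuous := h.continuous
  limit := by
    obtain ⟨φ, hφ⟩ := h.limit
    refine ⟨φ, fun u => ⟨fun ε hε => ?_, (hφ u).2⟩⟩
    refine ((hφ u).1 ε hε).congr fun m => measure_congr ?_
    filter_upwards [hae] with x hxe
    have heq : ∫⁻ s in Set.Iic u, ‖(φ m).process s x - H s x‖ₑ ^ 2 ∂timeMeasure τ₀
        = ∫⁻ s in Set.Iic u, ‖(φ m).process s x - H' s x‖ₑ ^ 2 ∂timeMeasure τ₀ := by
      refine lintegral_congr_ae (ae_restrict_of_ae ?_)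
      filter_upwards [hxe] with s hs
      rw [hs]
    exact congrArg (fun r => ε ≤ r) heq

/-- The Itô integral of the zero integrand is zero. -/
theorem isItoIntegral_zero (B : MarketTime τ₀ → Ω → ℝ) :
    IsItoIntegral 𝓕 P B (fun _ _ => 0) (fun _ _ => 0) where
  progressive := isStronglyProgressive_const 𝓕 0
  locally_sq_integrable := by simp
  adapted := fun _ => stronglyMeasurable_const
  continuous := Eventually.of_forall fun _ => continuous_const
  limit := by
    -- With `N = 0` both sums are empty; the remaining fields only have to be admissible.
    let φ : SimpleIntegrand 𝓕 :=
      { N := 0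
        t := fun _ => ⊥
        t_mono := monotone_const
        ξ := fun _ _ => 0
        measurable_ξ := fun _ => stronglyMeasurable_const
        bounded_ξ := ⟨0, by simp⟩ }
    refine ⟨fun _ => φ, fun u => ⟨fun ε hε => ?_, fun ε hε => ?_⟩⟩
    · simp [SimpleIntegrand.process, φ, hε.ne']
    · simp [SimpleIntegrand.integral, φ, hε.ne']

/-- A deterministic constant has the zero stochastic differential. -/
theorem hasItoDifferential_const (W : Fin n → MarketTime τ₀ → Ω → ℝ) (c : ℝ) :
    HasItoDifferential 𝓕 P W (fun _ _ => c) (fun _ _ => 0) (fun _ _ _ => 0) where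
  progressive := isStronglyProgressive_const 𝓕 c
  drift_progressive := isStronglyProgressive_const 𝓕 0
  drift_integrable := by simp
  representation := ⟨fun _ _ _ => 0, fun k => isItoIntegral_zero (W k), by simp⟩

/-- The coefficients of a stochastic differential may be replaced by progressively measurable
processes that agree with them at almost all times. -/
theorem HasItoDifferential.congr {W : Fin n → MarketTime τ₀ → Ω → ℝ}
    {X a a' : MarketTime τ₀ → Ω → ℝ} {b b' : Fin n → MarketTime τ₀ → Ω → ℝ}
    (h : HasItoDifferential 𝓕 P W X a b)
    (ha' : IsStronglyProgressive 𝓕 a') (hb' : ∀ k, IsStronglyProgressive 𝓕 (b' k))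
    (ha : ∀ᵐ x ∂P, ∀ᵐ s ∂timeMeasure τ₀, a s x = a' s x)
    (hb : ∀ k, ∀ᵐ x ∂P, ∀ᵐ s ∂timeMeasure τ₀, b k s x = b' k s x) :
    HasItoDifferential 𝓕 P W X a' b' where
  progressive := h.progressive
  drift_progressive := ha'
  drift_integrable := by
    filter_upwards [h.drift_integrable, ha] with x hx hxe u
    exact (hx u).congr (ae_restrict_of_ae hxe)
  representation := by
    obtain ⟨I, hI, hX⟩ := h.representation
    refine ⟨I, fun k => (hI k).congr (hb' k) (hb k), ?_⟩
    filter_upwards [hX, ha] with x hx hxe u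
    rw [hx u, integral_congr_ae (ae_restrict_of_ae hxe)]

end StochasticAnalysis

/-! ### Growth rate maximization with and without the savings account. -/

section Market

variable {Ω : Type*} {τ₀ : ℝ} {n : ℕ}

theorem factorReturn_apply (lam : MarketTime τ₀ → Ω → ℝ) (β : Fin n → MarketTime τ₀ → Ω → ℝ)
    (ω : Fin n → ℝ) (τ : MarketTime τ₀) (x : Ω) (k : Fin n) :
    factorReturn lam β ω τ x k = lam τ x + β k τ x * β k τ x * ω k := by
  simp [factorReturn, volMatrix, Matrix.diagonal_mul_diagonal, Matrix.mulVec_diagonal]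

theorem volMatrix_inv {β : Fin n → MarketTime τ₀ → Ω → ℝ} {τ : MarketTime τ₀} {x : Ω}
    (hβ : ∀ k, β k τ x ≠ 0) :
    (volMatrix β τ x)⁻¹ = Matrix.diagonal fun k => (β k τ x)⁻¹ := by
  refine Matrix.inv_eq_right_inv ?_
  simp [volMatrix, Matrix.diagonal_mul_diagonal, hβ]

theorem volMatrix_zpow_neg_two {β : Fin n → MarketTime τ₀ → Ω → ℝ} {τ : MarketTime τ₀} {x : Ω}
    (hβ : ∀ k, β k τ x ≠ 0) :
    volMatrix β τ x ^ (-2 : ℤ) = Matrix.diagonal fun k => (β k τ x ^ 2)⁻¹ := by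
  have h : volMatrix β τ x ^ (-2 : ℤ) = (volMatrix β τ x ^ 2)⁻¹ :=
    Matrix.zpow_neg_natCast _ 2
  rw [h]
  refine Matrix.inv_eq_right_inv ?_
  simp [volMatrix, Matrix.diagonal_pow, Matrix.diagonal_mul_diagonal, hβ]

/-- If the Lagrange multiplier of the growth rate maximization over the factors is the net
risk-adjusted return, then the premium parameters are the optimal weights, so they add up to one. -/
theorem sum_premium_eq_one {lam : MarketTime τ₀ → Ω → ℝ}
    {β : Fin n → MarketTime τ₀ → Ω → ℝ} {ω : Fin n → ℝ} {τ : MarketTime τ₀} {x : Ω}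
    (hβ : ∀ k, β k τ x ≠ 0)
    (h : IsLagrangeMultiplier (growthRate (factorReturn lam β ω τ x) (volMatrix β τ x))
      (lam τ x)) :
    ∑ k, ω k = 1 := by
  obtain ⟨π, hπ, hd⟩ := h
  -- The term `lam ∑ pₖ` in the return cancels the one in the multiplier penalty; what is left is a
  -- separable quadratic in which the square can be completed.
  have hlagr : ∀ p : Fin n → ℝ,
      growthRate (factorReturn lam β ω τ x) (volMatrix β τ x) p + lam τ x * (1 - ∑ k, p k)
        = lam τ x + (1 / 2) * ∑ k, (β k τ x * ω k) ^ 2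
          - (1 / 2) * ∑ k, (β k τ x * (p k - ω k)) ^ 2 := fun p => by
    simp only [growthRate, dotProduct, factorReturn_apply, volMatrix, Matrix.vecMul_diagonal,
      mul_sub (lam τ x), Finset.mul_sum, mul_one]
    -- Removes the isolated `lam`, so that the rest is an identity between sums that holds term by
    -- term.
    have hsplit : ∀ a b c d e l : ℝ, a - b - c + d - e = 0 →
        a - b + (l - c) = l + e - d := fun a b c d e l h => by linarith
    refine hsplit _ _ _ _ _ _ ?_
    rw [← Finset.sum_sub_distrib, ← Finset.sum_sub_distrib, ← Finset.sum_add_distrib,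
      ← Finset.sum_sub_distrib]
    exact Finset.sum_eq_zero fun k _ => by ring
  simp only [hlagr] at hd
  set Q : ℝ := ∑ k, (β k τ x * (π k - ω k)) ^ 2 with hQ
  -- The critical point is tested along the ray from `ω` through `π`. There the quadratic part is
  -- `-½ (1 + t)² Q`, with derivative `-Q` at `0`, while criticality makes this derivative zero.
  -- Hence `Q = 0`.
  have hline : HasDerivAt (fun t : ℝ => π + t • (π - ω)) (π - ω) 0 := by
    simpa using ((hasDerivAt_id (0 : ℝ)).smul_const (π - ω)).const_add π
  have hd₁ := HasFDerivAt.comp_hasDerivAt_of_eq (0 : ℝ) hd hline (by simp)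
  have hd₂ : HasDerivAt (fun t : ℝ => lam τ x + (1 / 2) * ∑ k, (β k τ x * ω k) ^ 2
      - (1 / 2) * ((1 + t) ^ 2 * Q)) (-Q) 0 := by
    have h := (((((hasDerivAt_id (0 : ℝ)).const_add 1).pow 2).mul_const Q).const_mul
      (1 / 2)).const_sub (lam τ x + (1 / 2) * ∑ k, (β k τ x * ω k) ^ 2)
    refine h.congr_deriv ?_
    simp
  have hQ₀ : Q = 0 := by
    refine neg_eq_zero.1 (hd₂.unique (hd₁.congr_of_eventuallyEq (Eventually.of_forall fun t => ?_)))
    simp only [Function.comp_apply, hQ, Finset.mul_sum]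
    congr 1
    refine Finset.sum_congr rfl fun k _ => ?_
    simp only [Pi.add_apply, Pi.smul_apply, Pi.sub_apply, smul_eq_mul]
    ring
  rw [← hπ.1]
  refine Finset.sum_congr rfl fun k _ => ?_
  have hk := (Finset.sum_eq_zero_iff_of_nonneg fun k _ => sq_nonneg _).1 hQ₀ k (Finset.mem_univ k)
  have hk' := (mul_eq_zero.1 (pow_eq_zero_iff two_ne_zero |>.1 hk)).resolve_left (hβ k)
  linarith

/-- The growth rate in the extended market is, up to a constant, minus half the squared distance
of the portfolio volatility from the market price of risk. -/
theorem extendedGrowthRate_eq {lam : MarketTime τ₀ → Ω → ℝ}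
    {β : Fin n → MarketTime τ₀ → Ω → ℝ} {ω : Fin n → ℝ} {τ : MarketTime τ₀} {x : Ω}
    {θ : Fin n → ℝ} (hθ : IsMarketPriceOfRisk lam β ω τ x θ) (p : Fin (n + 1) → ℝ) :
    extendedGrowthRate lam β ω τ x p
      = (1 / 2) * ∑ k, θ k ^ 2 - (1 / 2) * ∑ k, (p k.succ * β k τ x - θ k) ^ 2 := by
  have hret : ∀ k, factorReturn lam β ω τ x k = β k τ x * θ k := fun k => by
    have h := congrFun hθ k
    rwa [volMatrix, Matrix.mulVec_diagonal] at h
  -- The zero row of the savings account drops out, and the factor block is diagonal.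
  have hvol : ∀ j, (p ᵥ* (Matrix.of (Fin.cons 0 (fun k => volMatrix β τ x k) :
      Fin (n + 1) → Fin n → ℝ))) j = p j.succ * β j τ x := fun j => by
    simp [Matrix.vecMul, dotProduct, Fin.sum_univ_succ, volMatrix, Matrix.diagonal_apply]
  simp only [extendedGrowthRate, growthRate, dotProduct, hvol, Fin.sum_univ_succ, Fin.cons_zero,
    Fin.cons_succ, hret, mul_zero, zero_add, Finset.mul_sum]
  rw [← Finset.sum_sub_distrib, ← Finset.sum_sub_distrib]
  exact Finset.sum_congr rfl fun k _ => by ring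

/-- The unique maximizer of the growth rate in the extended market. -/
theorem isConstrainedMaximizer_extendedGrowthRate_iff {lam : MarketTime τ₀ → Ω → ℝ}
    {β : Fin n → MarketTime τ₀ → Ω → ℝ} {ω : Fin n → ℝ} {τ : MarketTime τ₀} {x : Ω}
    {θ : Fin n → ℝ} (hβ : ∀ k, β k τ x ≠ 0) (hθ : IsMarketPriceOfRisk lam β ω τ x θ)
    (p : Fin (n + 1) → ℝ) :
    IsConstrainedMaximizer (extendedGrowthRate lam β ω τ x) p ↔
      ∑ i, p i = 1 ∧ ∀ k : Fin n, p k.succ = θ k / β k τ x := by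
  refine and_congr_right fun hp => ?_
  simp only [extendedGrowthRate_eq hθ]
  refine ⟨fun hmax => ?_, fun h q _ => ?_⟩
  -- The competitor makes every square vanish and lets the savings account take up the rest of the
  -- budget.
  · have hle := hmax (Fin.cons (1 - ∑ k, θ k / β k τ x) fun k => θ k / β k τ x)
      (by simp [Fin.sum_univ_succ])
    have hzero : ∑ k, (p k.succ * β k τ x - θ k) ^ 2 = 0 := by
      refine le_antisymm ?_ (Finset.sum_nonneg fun k _ => sq_nonneg _)
      simp only [Fin.cons_succ, div_mul_cancel₀ _ (hβ _), sub_self] at hle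
      norm_num at hle
      linarith
    intro k
    have hk := (Finset.sum_eq_zero_iff_of_nonneg fun k _ => sq_nonneg _).1 hzero k
      (Finset.mem_univ k)
    rw [eq_div_iff (hβ k)]
    exact sub_eq_zero.1 (pow_eq_zero_iff two_ne_zero |>.1 hk)
  · have hq : 0 ≤ ∑ k, (q k.succ * β k τ x - θ k) ^ 2 := Finset.sum_nonneg fun k _ => sq_nonneg _
    simp only [h, div_mul_cancel₀ _ (hβ _), sub_self]
    norm_num
    linarith

end Market

end NumeraireMarket

/-! ### The numéraire portfolio and its dynamics. -/

open NumeraireMarket in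
theorem mainTheorem5 {Ω : Type*} {mΩ : MeasurableSpace Ω} (P : Measure Ω) [IsProbabilityMeasure P]
    (τ₀ : ℝ) (𝓕 : Filtration (NumeraireMarket.MarketTime τ₀) mΩ) (n : ℕ)
    (W : Fin n → NumeraireMarket.MarketTime τ₀ → Ω → ℝ)
    (lam : NumeraireMarket.MarketTime τ₀ → Ω → ℝ)
    (β : Fin n → NumeraireMarket.MarketTime τ₀ → Ω → ℝ) (ω : Fin n → ℝ)
    (S : Fin n → NumeraireMarket.MarketTime τ₀ → Ω → ℝ)
    (hM : NumeraireMarket.IsFactorMarket 𝓕 P W lam β ω S)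
    (θ : NumeraireMarket.MarketTime τ₀ → Ω → Fin n → ℝ)
    (hθ : ∀ τ x, θ τ x = lam τ x • ((NumeraireMarket.volMatrix β τ x)⁻¹ *ᵥ 1)
      + NumeraireMarket.volMatrix β τ x *ᵥ ω) :
    (∀ τ x, NumeraireMarket.IsMarketPriceOfRisk lam β ω τ x (θ τ x)) ∧
    (∀ᵐ x ∂P, ∀ τ, ∀ p : Fin (n + 1) → ℝ,
      NumeraireMarket.IsConstrainedMaximizer
        (NumeraireMarket.extendedGrowthRate lam β ω τ x) p ↔
      p = Fin.cons
        (-(lam τ x * ((1 : Fin n → ℝ) ⬝ᵥ (NumeraireMarket.volMatrix β τ x ^ (-2 : ℤ) *ᵥ 1))))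
        (lam τ x • (NumeraireMarket.volMatrix β τ x ^ (-2 : ℤ) *ᵥ 1) + ω)) ∧
    ∀ (V : NumeraireMarket.MarketTime τ₀ → Ω → ℝ)
      (π : Fin (n + 1) → NumeraireMarket.MarketTime τ₀ → Ω → ℝ),
      NumeraireMarket.IsNumerairePortfolio 𝓕 P W lam β ω S V π →
      NumeraireMarket.HasItoDifferential 𝓕 P W V
        (fun τ x => V τ x * (θ τ x ⬝ᵥ θ τ x)) (fun k τ x => V τ x * θ τ x k) ∧
      (∀ᵐ x ∂P, 0 < V ⊥ x) ∧
      (∀ᵐ x ∂P, ∀ τ, (fun k : Fin n => π k.succ τ x)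
        = lam τ x • (NumeraireMarket.volMatrix β τ x ^ (-2 : ℤ) *ᵥ 1) + ω) ∧
      (∀ᵐ x ∂P, ∀ τ, π 0 τ x
        = -(lam τ x * ((1 : Fin n → ℝ) ⬝ᵥ (NumeraireMarket.volMatrix β τ x ^ (-2 : ℤ) *ᵥ 1)))) := by
  have hβ : ∀ k τ x, β k τ x ≠ 0 := fun k τ x => (hM.vol_pos k τ x).ne'
  have hθk : ∀ τ x k, θ τ x k = lam τ x * (β k τ x)⁻¹ + β k τ x * ω k := fun τ x k => by
    rw [hθ, volMatrix_inv fun k => hβ k τ x]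
    simp [volMatrix, Matrix.mulVec_diagonal]
  have hmpr : ∀ τ x, IsMarketPriceOfRisk lam β ω τ x (θ τ x) := fun τ x => by
    ext k
    rw [factorReturn_apply, volMatrix, Matrix.mulVec_diagonal, hθk]
    have := hβ k τ x
    field_simp
  have hw : ∀ τ x, lam τ x • (volMatrix β τ x ^ (-2 : ℤ) *ᵥ 1) + ω
      = fun k => θ τ x k / β k τ x := fun τ x => by
    ext k
    rw [volMatrix_zpow_neg_two fun k => hβ k τ x, hθk]
    have := hβ k τ x
    simp only [Pi.add_apply, Pi.smul_apply, Matrix.mulVec_diagonal, Pi.one_apply, smul_eq_mul]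
    field_simp
  have hmax : ∀ᵐ x ∂P, ∀ τ, ∀ p : Fin (n + 1) → ℝ,
      IsConstrainedMaximizer (extendedGrowthRate lam β ω τ x) p ↔
      p = Fin.cons
        (-(lam τ x * ((1 : Fin n → ℝ) ⬝ᵥ (volMatrix β τ x ^ (-2 : ℤ) *ᵥ 1))))
        (lam τ x • (volMatrix β τ x ^ (-2 : ℤ) *ᵥ 1) + ω) := by
    filter_upwards [hM.net_risk_adjusted_return] with x hx τ p
    rw [isConstrainedMaximizer_extendedGrowthRate_iff (fun k => hβ k τ x) (hmpr τ x)]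
    -- This is where the multiplier hypothesis enters: the total wealth `1` is rewritten as `∑ ωₖ`,
    -- which cancels the premium part of the factor weights.
    have hsum : -(lam τ x * ((1 : Fin n → ℝ) ⬝ᵥ (volMatrix β τ x ^ (-2 : ℤ) *ᵥ 1)))
        = 1 - ∑ k, θ τ x k / β k τ x := by
      rw [← sum_premium_eq_one (fun k => hβ k τ x) (hx τ)]
      have h := congrArg (fun v : Fin n → ℝ => ∑ k, v k) (hw τ x)
      simp only [Pi.add_apply, Pi.smul_apply, smul_eq_mul, Finset.sum_add_distrib] at h
      rw [← h, dotProduct, Finset.mul_sum]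
      simp
    rw [hsum, hw]
    constructor
    · rintro ⟨hp, hk⟩
      rw [Fin.sum_univ_succ] at hp
      simp only [hk] at hp
      refine (Fin.cons_self_tail p).symm.trans ?_
      congr 1
      · linarith
      · exact funext hk
    · rintro rfl
      simp [Fin.sum_univ_succ]
  refine ⟨hmpr, hmax, fun V π hV => ?_⟩
  have hπ : ∀ᵐ x ∂P, ∀ τ, (fun i => π i τ x) = Fin.cons
        (-(lam τ x * ((1 : Fin n → ℝ) ⬝ᵥ (volMatrix β τ x ^ (-2 : ℤ) *ᵥ 1))))
        (lam τ x • (volMatrix β τ x ^ (-2 : ℤ) *ᵥ 1) + ω) := by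
    filter_upwards [hmax, hV.growth_optimal] with x h₁ h₂ τ
    exact (h₁ τ _).1 (h₂ τ)
  have hπs : ∀ᵐ x ∂P, ∀ τ, (fun k : Fin n => π k.succ τ x)
      = lam τ x • (volMatrix β τ x ^ (-2 : ℤ) *ᵥ 1) + ω := by
    filter_upwards [hπ] with x hx τ
    ext k
    simpa using congrFun (hx τ) k.succ
  refine ⟨?_, ?_, hπs, ?_⟩
  -- The self-financing condition accepts any Itô representation of the securities: zero
  -- coefficients are supplied for the constant savings account and the factor SDE for the others.
  · have hd := hV.portfolio.self_financing.2
      (Fin.cons (fun _ _ => 0)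
        fun k τ x => S k τ x * (lam τ x + β k τ x * (β k τ x * ω k)))
      (Fin.cons (fun _ _ _ => 0)
        fun k j τ x => if j = k then S k τ x * β k τ x else 0)
      (Fin.cases (hasItoDifferential_const W 1) hM.factor_sde)
    have hβprog : ∀ k, IsStronglyProgressive 𝓕 (β k) := fun k =>
      (hM.vol_adapted k).isStronglyProgressive_of_continuous (hM.vol_continuous k)
    have hθprog : ∀ k, IsStronglyProgressive 𝓕 fun τ x => θ τ x k := fun k => by
      simp only [hθk]
      exact (hM.lam_progressive.mul fun i => (hβprog k i).inv₀).add
        ((hβprog k).mul (isStronglyProgressive_const 𝓕 (ω k)))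
    -- Instantaneous reflection: the zero set of each of the finitely many factors is null, so
    -- division by `S` is harmless at almost every time.
    have hS : ∀ᵐ x ∂P, ∀ᵐ s ∂timeMeasure τ₀, ∀ k, S k s x ≠ 0 := by
      filter_upwards [ae_all_iff.2 hM.factor_reflected] with x hx
      exact ae_all_iff.2 fun k => by simpa [ae_iff] using hx k
    refine hd.congr ?_ (fun k => hd.progressive.mul (hθprog k)) ?_ fun j => ?_
    · exact hd.progressive.mul
        (IsStronglyProgressive.finsetSum fun k _ => (hθprog k).mul (hθprog k))
    · filter_upwards [hπs, hS] with x hx hSx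
      filter_upwards [hSx] with s hs
      rw [Fin.sum_univ_succ]
      simp only [Fin.cons_zero, Fin.cons_succ, extendedSecurities, mul_zero, zero_add, dotProduct,
        Finset.mul_sum]
      refine Finset.sum_congr rfl fun k _ => ?_
      have hk : π k.succ s x = θ s x k / β k s x := (congrFun (hx s) k).trans (congrFun (hw s x) k)
      have h₁ := hβ k s x
      have h₂ := hs k
      rw [hk, hθk]
      field_simp
    -- Factor `j` is the only security driven by `W j`, so the sum over securities collapses to one
    -- term.
    · filter_upwards [hπs, hS] with x hx hSx
      filter_upwards [hSx] with s hs
      rw [Fin.sum_univ_succ]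
      simp only [Fin.cons_zero, Fin.cons_succ, extendedSecurities, mul_zero, zero_add, mul_ite,
        Finset.sum_ite_eq, Finset.mem_univ, if_true]
      have hk : π j.succ s x = θ s x j / β j s x := (congrFun (hx s) j).trans (congrFun (hw s x) j)
      have h₁ := hβ j s x
      have h₂ := hs j
      rw [hk]
      field_simp
  · filter_upwards [hV.portfolio.positive] with x hx
    exact hx ⊥
  · filter_upwards [hπ] with x hx τ
    simpa using congrFun (hx τ) 0
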